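/- Let $\mathcal S,\mathcal A$ be finite sets with $|\mathcal S|=S$ and $|\mathcal A|=A$, let $H,K\ge 1$ be integers (the horizon and the number of episodes), let $p$ be a probability distribution on $\mathcal S$, and let $P$ be a transition kernel, i.e. $P(\cdot\mid s,a,h)$ is a probability distribution on $\mathcal S$ for each $(s,a,h)\in\mathcal S\times\mathcal A\times[H]$. A policy $\pi$ assigns to each $(s,h)$ a probability distribution $\pi(\cdot\mid s,h)$ on $\mathcal A$. For $\ell:\mathcal S\times\mathcal A\times[H]\to\mathbb R$ put $V_1^\pi(\ell,P)=\mathbb E\big[\sum_{h=1}^H\ell(s_h,a_h,h)\big]$, where $s_1\sim p$, $a_h\sim\pi(\cdot\mid s_h,h)$ and $s_{h+1}\sim P(\cdot\mid s_h,a_h,h)$ for $h\in[H]$. A learner interacts with this process for $K$ episodes: before episode $k$ it chooses a policy from the information available so far (the trajectories of the earlier episodes and any further observations or internal randomness), and, conditionally on that information, the trajectory $(s_1,a_1,\dots,s_H,a_H,s_{H+1})$ of episode $k$ is generated by $p$, that policy and $P$. Let $N_k(s,a,h)$ and $M_k(s,a,s',h)$ be the numbers of episodes among the first $k-1$ in which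 $(s_h,a_h)=(s,a)$, respectively $(s_h,a_h,s_{h+1})=(s,a,s')$. Fix $\delta\in(0,1)$ and write $L=\ln(HSAK/\delta)$, $n_k(s,a,h)=\max\{1,N_k(s,a,h)-1\}$, $\bar P_k(s'\mid s,a,h)=M_k(s,a,s',h)/\max\{1,N_k(s,a,h)\}$ and $$\epsilon_k(s'\mid s,a,h)=2\sqrt{\frac{\bar P_k(s'\mid s,a,h)\,L}{n_k(s,a,h)}}+\frac{14L}{3n_k(s,a,h)}.$$ Let $\mathcal P_k$ be the set of transition kernels $\widehat P$ with $|\widehat P(s'\mid s,a,h)-\bar P_k(s'\mid s,a,h)|\le\epsilon_k(s'\mid s,a,h)$ for all $(s,a,s',h)$. Define $$U_k(s,a,h)=8\sqrt H\,\varepsilon_k(s,a,h)+4S\sqrt{\frac{HA}{K}}+\frac{2\sqrt{HK/A}\,L+\eta}{n_k(s,a,h)},$$ $$\varepsilon_k(s,a,h)=2\sqrt{\frac{S L}{n_k(s,a,h)}}+\frac{14SL}{3n_k(s,a,h)},\qquad \eta=\big(19HS+2H^{1.5}S+10^4H^2S^2\big)L^2 .$$ Then, with probability at least $1-14\delta$,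 $$\big|V_1^{\pi_k}(g,P)-V_1^{\pi_k}(g,P_k)\big|\le V_1^{\pi_k}(U_k,P_k)$$ for every episode $k\in[K]$, every policy $\pi_k$, every $P_k\in\mathcal P_k$ and every $g:\mathcal S\times\mathcal A\times[H]\to[0,1]$. -/

import Mathlib

open MeasureTheory ProbabilityTheory

noncomputable section

namespace CMDP

/-- A trajectory of one episode with horizon `H`: the states `s_1, …, s_{H+1}` (indexed by
`Fin (H + 1)`) and the actions `a_1, …, a_H` (indexed by `Fin H`; index `h` is step `h + 1`). -/
abbrev Traj (S A : Type*) (H : ℕ) : Type _ := (Fin (H + 1) → S) × (Fin H → A)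

/-- `P h s a s'` is the probability of moving from `s` to `s'` under action `a` at step `h`. -/
def IsKernel {S A : Type*} [Fintype S] {H : ℕ} (P : Fin H → S → A → S → ℝ) : Prop :=
  ∀ h s a, P h s a ∈ stdSimplex ℝ S

/-- `π h s a` is the probability of playing action `a` in state `s` at step `h`. -/
def IsPolicy {S A : Type*} [Fintype A] {H : ℕ} (π : Fin H → S → A → ℝ) : Prop :=
  ∀ h s, π h s ∈ stdSimplex ℝ A

/-- The probability of the trajectory `τ` when `s_1 ∼ p`, `a_h ∼ π(· ∣ s_h, h)` and
`s_{h+1} ∼ P(· ∣ s_h, a_h, h)`. -/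
def trajProb {S A : Type*} {H : ℕ} (p : S → ℝ) (P : Fin H → S → A → S → ℝ)
    (π : Fin H → S → A → ℝ) (τ : Traj S A H) : ℝ :=
  p (τ.1 0) * ∏ h : Fin H,
    (π h (τ.1 h.castSucc) (τ.2 h) * P h (τ.1 h.castSucc) (τ.2 h) (τ.1 h.succ))

/-- `V_1^π(ℓ, P)`: the expected value of `∑_h ℓ(s_h, a_h, h)` over the trajectory generated by
the initial distribution `p`, the policy `π` and the kernel `P`. -/
def value {S A : Type*} [Fintype S] [Fintype A] {H : ℕ} (p : S → ℝ) (π : Fin H → S → A → ℝ)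
    (ℓ : Fin H → S → A → ℝ) (P : Fin H → S → A → S → ℝ) : ℝ :=
  ∑ τ : Traj S A H, trajProb p P π τ * ∑ h : Fin H, ℓ h (τ.1 h.castSucc) (τ.2 h)

/-- Episodic interaction of an arbitrary adaptive learner with the MDP `(p, P)` over `K` episodes.
`ℱ k` is the information available before episode `k`: it contains the trajectories of all earlier
episodes, and it may contain anything else (noisy reward and cost observations, internal
randomness). The policy `π k` is chosen from that information, and, given it, the trajectory
`X k` of episode `k` is generated by `p`, `π k` and `P`. -/
structure IsLearningRun {S A : Type*} [Fintype S] [Fintype A] {H K : ℕ}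
    {Ω : Type*} [mΩ : MeasurableSpace Ω] (μ : Measure Ω) (p : S → ℝ)
    (P : Fin H → S → A → S → ℝ) (ℱ : Filtration (Fin K) mΩ)
    (π : Fin K → Ω → Fin H → S → A → ℝ) (X : Fin K → Ω → Traj S A H) : Prop where
  isPolicy : ∀ k ω, IsPolicy (π k ω)
  policy_measurable : ∀ k h s a, Measurable[ℱ k] fun ω => π k ω h s a
  traj_measurable : ∀ k τ, MeasurableSet (X k ⁻¹' {τ})
  past_measurable : ∀ j k τ, j < k → MeasurableSet[ℱ k] (X j ⁻¹' {τ})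
  traj_law : ∀ k τ,
    μ[(X k ⁻¹' {τ}).indicator (fun _ => (1 : ℝ)) | ℱ k] =ᵐ[μ] fun ω => trajProb p P (π k ω) τ

section Estimators

variable {S A : Type*} [DecidableEq S] [DecidableEq A] {H K : ℕ}

/-- `N_k(s, a, h)`: the number of episodes before `k` that visit `(s, a)` at step `h`. -/
def visits (x : Fin K → Traj S A H) (k : Fin K) (h : Fin H) (s : S) (a : A) : ℕ :=
  (Finset.univ.filter fun j : Fin K =>
    j < k ∧ (x j).1 h.castSucc = s ∧ (x j).2 h = a).card

/-- `M_k(s, a, s', h)`: the number of episodes before `k` that visit `(s, a)` at step `h` and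
then move to `s'`. -/
def transitions (x : Fin K → Traj S A H) (k : Fin K) (h : Fin H) (s : S) (a : A) (s' : S) : ℕ :=
  (Finset.univ.filter fun j : Fin K =>
    j < k ∧ (x j).1 h.castSucc = s ∧ (x j).2 h = a ∧ (x j).1 h.succ = s').card

/-- The empirical transition kernel `M_k(s, a, s', h) / max {1, N_k(s, a, h)}`. -/
def empKernel (x : Fin K → Traj S A H) (k : Fin K) (h : Fin H) (s : S) (a : A) (s' : S) : ℝ :=
  (transitions x k h s a s' : ℝ) / max 1 (visits x k h s a : ℝ)

/-- `max {1, N_k(s, a, h) - 1}`, with the subtraction taken in the reals. -/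
def effVisits (x : Fin K → Traj S A H) (k : Fin K) (h : Fin H) (s : S) (a : A) : ℝ :=
  max 1 ((visits x k h s a : ℝ) - 1)

/-- `ln (H S A K / δ)`. -/
def logTerm (S A : Type*) [Fintype S] [Fintype A] (H K : ℕ) (δ : ℝ) : ℝ :=
  Real.log ((H : ℝ) * (Fintype.card S : ℝ) * (Fintype.card A : ℝ) * (K : ℝ) / δ)

variable [Fintype S] [Fintype A]

/-- The confidence radius `ϵ_k(s' ∣ s, a, h)`. -/
def radius (δ : ℝ) (x : Fin K → Traj S A H) (k : Fin K) (h : Fin H) (s : S) (a : A) (s' : S) : ℝ :=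
  2 * Real.sqrt (empKernel x k h s a s' * logTerm S A H K δ / effVisits x k h s a)
    + 14 * logTerm S A H K δ / (3 * effVisits x k h s a)

/-- The confidence set `𝒫_k`. -/
def confidenceSet (δ : ℝ) (x : Fin K → Traj S A H) (k : Fin K) : Set (Fin H → S → A → S → ℝ) :=
  {Q | IsKernel Q ∧ ∀ h s a s', |Q h s a s' - empKernel x k h s a s'| ≤ radius δ x k h s a s'}

/-- `ε_k(s, a, h)`. -/
def vareps (δ : ℝ) (x : Fin K → Traj S A H) (k : Fin K) (h : Fin H) (s : S) (a : A) : ℝ :=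
  2 * Real.sqrt ((Fintype.card S : ℝ) * logTerm S A H K δ / effVisits x k h s a)
    + 14 * (Fintype.card S : ℝ) * logTerm S A H K δ / (3 * effVisits x k h s a)

/-- `η = (19 H S + 2 H^{1.5} S + 10^4 H^2 S^2) (ln (H S A K / δ))^2`. -/
def eta (S A : Type*) [Fintype S] [Fintype A] (H K : ℕ) (δ : ℝ) : ℝ :=
  (19 * (H : ℝ) * (Fintype.card S : ℝ) + 2 * (H : ℝ) ^ (3 / 2 : ℝ) * (Fintype.card S : ℝ)
    + 10 ^ 4 * (H : ℝ) ^ 2 * (Fintype.card S : ℝ) ^ 2) * logTerm S A H K δ ^ 2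

/-- The extra pessimism `U_k(s, a, h)`. -/
def pessimism (δ : ℝ) (x : Fin K → Traj S A H) (k : Fin K) (h : Fin H) (s : S) (a : A) : ℝ :=
  8 * Real.sqrt (H : ℝ) * vareps δ x k h s a
    + 4 * (Fintype.card S : ℝ) * Real.sqrt ((H : ℝ) * (Fintype.card A : ℝ) / (K : ℝ))
    + (2 * Real.sqrt ((H : ℝ) * (K : ℝ) / (Fintype.card A : ℝ)) * logTerm S A H K δ
        + eta S A H K δ) / effVisits x k h s a

end Estimators

end CMDP

end

/-!
The transition counts of a fixed `(s, a, s')` at a fixed step are controlled by an exponential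
supermartingale, so outside an event of probability `2 * δ` every count is within a Bernstein
radius of the visit count times `P`. Every kernel `Q` of a confidence set then satisfies
`|P - Q| ≤ 5 * √(Q * L / n) + 40 * L / n` entrywise.

Such an entrywise bound perturbs the expected next value by at most `c` times its variance under
`Q`, plus a multiple of `L / n`, plus `1 + 1 / (10 * H)` times the expected gap between the two
next values. Backward recursion turns this into an expectation along the trajectories of `Q`: the
last factor accumulates to at most `(1 + 1 / (10 * H)) ^ H ≤ 10 / 9`, and the variances add up to at
most `H ^ 2` by the law of total variance. Balancing `c` gives the term `4 * S * √(H * A / K)` of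
the pessimism, at the price of a multiple of `√(H * K / A) * L / n`; the remaining terms are
dominated by `η / n`.
-/

namespace CMDP

open scoped Matrix

section StdSimplex

variable {ι : Type*} [Fintype ι] {p q u v : ι → ℝ} {a b α β R c lam x : ℝ}

theorem nonempty_of_mem_stdSimplex (hq : q ∈ stdSimplex ℝ ι) : Nonempty ι := by
  by_contra hι
  rw [not_nonempty_iff] at hι
  simp [stdSimplex_of_isEmpty_index] at hq

theorem abs_dotProduct_le (hq : 0 ≤ q) (v : ι → ℝ) : |q ⬝ᵥ v| ≤ q ⬝ᵥ |v| :=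
  (Finset.abs_sum_le_sum_abs _ _).trans_eq <|
    Finset.sum_congr rfl fun i _ => by rw [abs_mul, abs_of_nonneg (hq i), Pi.abs_apply]

theorem dotProduct_const_of_mem_stdSimplex (hq : q ∈ stdSimplex ℝ ι) (a : ℝ) :
    q ⬝ᵥ (fun _ => a) = a := by
  rw [dotProduct, ← Finset.sum_mul, hq.2, one_mul]

theorem dotProduct_mem_Icc (hq : q ∈ stdSimplex ℝ ι) (hv : ∀ i, v i ∈ Set.Icc a b) :
    q ⬝ᵥ v ∈ Set.Icc a b :=
  (convex_Icc a b).sum_mem (fun i _ => hq.1 i) hq.2 fun i _ => hv i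

/-- The variance of `v` under the weights `q`. -/
def weightedVariance (q v : ι → ℝ) : ℝ :=
  q ⬝ᵥ fun i => (v i - q ⬝ᵥ v) ^ 2

theorem weightedVariance_nonneg (hq : 0 ≤ q) (v : ι → ℝ) : 0 ≤ weightedVariance q v :=
  dotProduct_nonneg_of_nonneg hq fun _ => sq_nonneg _

theorem weightedVariance_add_dotProduct_mul_sub (hq : q ∈ stdSimplex ℝ ι) (v : ι → ℝ) (R : ℝ) :
    weightedVariance q v + q ⬝ᵥ (fun i => v i * (R - v i)) = (q ⬝ᵥ v) * (R - q ⬝ᵥ v) := by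
  have hpoint : ((fun i => (v i - q ⬝ᵥ v) ^ 2) + fun i => v i * (R - v i))
      = (R - 2 * (q ⬝ᵥ v)) • v + fun _ => (q ⬝ᵥ v) ^ 2 := by
    ext i
    simp only [Pi.add_apply, Pi.smul_apply, smul_eq_mul]
    ring
  rw [weightedVariance, ← dotProduct_add, hpoint, dotProduct_add, dotProduct_smul,
    dotProduct_const_of_mem_stdSimplex hq, smul_eq_mul]
  ring

theorem dotProduct_mul_sub_le (hq : q ∈ stdSimplex ℝ ι) (v : ι → ℝ) (R : ℝ) :
    q ⬝ᵥ (fun i => v i * (R - v i)) ≤ (q ⬝ᵥ v) * (R - q ⬝ᵥ v) := by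
  rw [← weightedVariance_add_dotProduct_mul_sub hq]
  exact le_add_of_nonneg_left (weightedVariance_nonneg hq.1 v)

theorem mul_sqrt_mul_mul_le {y t : ℝ} (hy : 0 ≤ y) (hx : 0 ≤ x) (hc : 0 < c) :
    α * √(y * x) * t ≤ c * (y * t ^ 2) + α ^ 2 / (4 * c) * x := by
  calc α * √(y * x) * t = 2 * (√y * t) * (α * √x / 2) := by rw [Real.sqrt_mul hy]; ring
    _ ≤ c * (√y * t) ^ 2 + c⁻¹ * (α * √x / 2) ^ 2 := two_mul_le_add_mul_sq hc
    _ = c * (y * t ^ 2) + α ^ 2 / (4 * c) * x := by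
      rw [mul_pow, div_pow, mul_pow, Real.sq_sqrt hy, Real.sq_sqrt hx]
      field_simp
      ring

theorem abs_sub_dotProduct_le_sq (hq : 0 ≤ q) (hx : 0 ≤ x) (hβ : 0 ≤ β) (hc : 0 < c)
    (hpq : ∀ i, |p i - q i| ≤ α * √(q i * x) + β * x) (hv : ∀ i, |v i| ≤ R) :
    |(p - q) ⬝ᵥ v|
      ≤ c * (q ⬝ᵥ fun i => v i ^ 2) + Fintype.card ι * (α ^ 2 / (4 * c) + R * β) * x := by
  have hterm (i : ι) : |(p i - q i) * v i|
      ≤ c * (q i * v i ^ 2) + (α ^ 2 / (4 * c) + R * β) * x := by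
    calc |(p i - q i) * v i| ≤ (α * √(q i * x) + β * x) * |v i| := by
          rw [abs_mul]
          gcongr
          exact hpq i
      _ = α * √(q i * x) * |v i| + β * x * |v i| := by ring
      _ ≤ (c * (q i * |v i| ^ 2) + α ^ 2 / (4 * c) * x) + β * x * R := by
          gcongr
          · exact mul_sqrt_mul_mul_le (hq i) hx hc
          · exact hv i
      _ = c * (q i * v i ^ 2) + (α ^ 2 / (4 * c) + R * β) * x := by rw [sq_abs]; ring
  calc |(p - q) ⬝ᵥ v| ≤ ∑ i, |(p i - q i) * v i| := Finset.abs_sum_le_sum_abs _ _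
    _ ≤ ∑ i, (c * (q i * v i ^ 2) + (α ^ 2 / (4 * c) + R * β) * x) :=
        Finset.sum_le_sum fun i _ => hterm i
    _ = _ := by
        rw [Finset.sum_add_distrib, ← Finset.mul_sum, Finset.sum_const, Finset.card_univ,
          nsmul_eq_mul, dotProduct, mul_assoc]

theorem abs_sub_dotProduct_le_abs (hq : 0 ≤ q) (hx : 0 ≤ x) (hβ : 0 ≤ β) (hlam : 0 < lam)
    (hpq : ∀ i, |p i - q i| ≤ α * √(q i * x) + β * x) (hv : ∀ i, |v i| ≤ R) :
    |(p - q) ⬝ᵥ v|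
      ≤ lam * (q ⬝ᵥ |v|) + Fintype.card ι * (R * (β + α ^ 2 / (4 * lam))) * x := by
  have hterm (i : ι) : |(p i - q i) * v i|
      ≤ lam * (q i * |v i|) + R * (β + α ^ 2 / (4 * lam)) * x := by
    calc |(p i - q i) * v i| ≤ (α * √(q i * x) * 1 + β * x) * |v i| := by
          rw [abs_mul, mul_one]
          gcongr
          exact hpq i
      _ ≤ (lam * (q i * 1 ^ 2) + α ^ 2 / (4 * lam) * x + β * x) * |v i| := by
          gcongr
          exact mul_sqrt_mul_mul_le (hq i) hx hlam
      _ = lam * (q i * |v i|) + (β + α ^ 2 / (4 * lam)) * x * |v i| := by ring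
      _ ≤ lam * (q i * |v i|) + (β + α ^ 2 / (4 * lam)) * x * R := by gcongr; exact hv i
      _ = lam * (q i * |v i|) + R * (β + α ^ 2 / (4 * lam)) * x := by ring
  calc |(p - q) ⬝ᵥ v| ≤ ∑ i, |(p i - q i) * v i| := Finset.abs_sum_le_sum_abs _ _
    _ ≤ ∑ i, (lam * (q i * |v i|) + R * (β + α ^ 2 / (4 * lam)) * x) :=
        Finset.sum_le_sum fun i _ => hterm i
    _ = _ := by
        simp only [Finset.sum_add_distrib, ← Finset.mul_sum, Finset.sum_const, Finset.card_univ,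
          nsmul_eq_mul, dotProduct, Pi.abs_apply]
        ring

theorem abs_dotProduct_sub_dotProduct_le (hp : p ∈ stdSimplex ℝ ι) (hq : q ∈ stdSimplex ℝ ι)
    (hx : 0 ≤ x) (hβ : 0 ≤ β) (hc : 0 < c) (hlam : 0 < lam)
    (hpq : ∀ i, |p i - q i| ≤ α * √(q i * x) + β * x)
    (hu : ∀ i, u i ∈ Set.Icc 0 R) (hv : ∀ i, v i ∈ Set.Icc 0 R) :
    |p ⬝ᵥ u - q ⬝ᵥ v|
      ≤ c * weightedVariance q v
        + Fintype.card ι * (α ^ 2 / (4 * c) + R * (2 * β + α ^ 2 / (4 * lam))) * x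
        + (1 + lam) * (q ⬝ᵥ |u - v|) := by
  have hM := dotProduct_mem_Icc hq hv
  have hcentred := abs_sub_dotProduct_le_sq (v := fun i => v i - q ⬝ᵥ v) hq.1 hx hβ hc hpq
    fun i => abs_sub_le_of_le_of_le (hv i).1 (hv i).2 hM.1 hM.2 |>.trans_eq (sub_zero R)
  have hdiff := abs_sub_dotProduct_le_abs (v := u - v) hq.1 hx hβ hlam hpq
    fun i => abs_sub_le_of_le_of_le (hu i).1 (hu i).2 (hv i).1 (hv i).2 |>.trans_eq (sub_zero R)
  have hdecomp : p ⬝ᵥ u - q ⬝ᵥ v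
      = (p - q) ⬝ᵥ (v - fun _ => q ⬝ᵥ v) + (p - q) ⬝ᵥ (u - v) + q ⬝ᵥ (u - v) := by
    simp only [sub_dotProduct, dotProduct_sub, dotProduct_const_of_mem_stdSimplex hp,
      dotProduct_const_of_mem_stdSimplex hq]
    ring
  calc |p ⬝ᵥ u - q ⬝ᵥ v|
      ≤ |(p - q) ⬝ᵥ (v - fun _ => q ⬝ᵥ v)| + |(p - q) ⬝ᵥ (u - v)| + |q ⬝ᵥ (u - v)| := by
        rw [hdecomp]
        exact abs_add_three _ _ _
    _ ≤ _ := add_le_add_three hcentred hdiff (abs_dotProduct_le hq.1 _)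
    _ = _ := by rw [weightedVariance]; ring

end StdSimplex

section Values

variable {S A : Type*} {H : ℕ} {π ℓ ℓ' : Fin H → S → A → ℝ} {P : Fin H → S → A → S → ℝ}

theorem trajProb_nonneg {p : S → ℝ} (hp : 0 ≤ p) (hP : ∀ h s a, 0 ≤ P h s a)
    (hπ : ∀ h s, 0 ≤ π h s) (τ : Traj S A H) : 0 ≤ trajProb p P π τ :=
  mul_nonneg (hp _) <| Finset.prod_nonneg fun h _ => mul_nonneg (hπ h _ _) (hP h _ _ _)

theorem trajProb_cons (p : S → ℝ) (P : Fin (H + 1) → S → A → S → ℝ)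
    (π : Fin (H + 1) → S → A → ℝ) (s : S) (a : A) (τ : Traj S A H) :
    trajProb p P π ((Fin.cons s τ.1 : Fin (H + 2) → S), (Fin.cons a τ.2 : Fin (H + 1) → A))
      = p s * (π 0 s a * trajProb (P 0 s a) (Fin.tail P) (Fin.tail π) τ) := by
  simp only [trajProb, Fin.prod_univ_succ, Fin.cons_zero, Fin.cons_succ, Fin.castSucc_zero,
    ← Fin.succ_castSucc, Fin.tail]
  ring

variable [Fintype S] [Fintype A]

/-- The one-step Bellman operator of a policy: the expected loss of the step plus the expected
value `V` of the next state. -/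
def bellman (π ℓ : S → A → ℝ) (P : S → A → S → ℝ) (V : S → ℝ) (s : S) : ℝ :=
  π s ⬝ᵥ fun a => ℓ s a + P s a ⬝ᵥ V

theorem bellman_mono {π ℓ : S → A → ℝ} {P : S → A → S → ℝ} (hP : ∀ s a, 0 ≤ P s a)
    (hπ : ∀ s, 0 ≤ π s) : Monotone (bellman π ℓ P) := fun _ _ hV s =>
  dotProduct_le_dotProduct_of_nonneg_left
    (fun a => by gcongr; exact dotProduct_le_dotProduct_of_nonneg_left hV (hP s a)) (hπ s)

/-- `stateValue π ℓ P h s` is the expected loss collected from step `h` on when the state at step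
`h` is `s`, defined by backward recursion from `0` at the last index. -/
def stateValue (π ℓ : Fin H → S → A → ℝ) (P : Fin H → S → A → S → ℝ) : Fin (H + 1) → S → ℝ :=
  Fin.reverseInduction (fun _ => 0) fun h V => bellman (π h) (ℓ h) (P h) V

theorem stateValue_last : stateValue π ℓ P (Fin.last H) = fun _ => 0 :=
  Fin.reverseInduction_last ..

theorem stateValue_castSucc (h : Fin H) :
    stateValue π ℓ P h.castSucc = bellman (π h) (ℓ h) (P h) (stateValue π ℓ P h.succ) :=
  Fin.reverseInduction_castSucc ..

theorem stateValue_le (hP : IsKernel P) (hπ : IsPolicy π) {V : Fin (H + 1) → S → ℝ}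
    (hlast : 0 ≤ V (Fin.last H)) (hstep : ∀ h, bellman (π h) (ℓ h) (P h) (V h.succ) ≤ V h.castSucc)
    (h : Fin (H + 1)) : stateValue π ℓ P h ≤ V h := by
  induction h using Fin.reverseInduction with
  | last => rwa [stateValue_last]
  | cast h ih =>
    rw [stateValue_castSucc]
    exact (bellman_mono (fun s a => (hP h s a).1) (fun s => (hπ h s).1) ih).trans (hstep h)

theorem le_stateValue (hP : IsKernel P) (hπ : IsPolicy π) {V : Fin (H + 1) → S → ℝ}
    (hlast : V (Fin.last H) ≤ 0) (hstep : ∀ h, V h.castSucc ≤ bellman (π h) (ℓ h) (P h) (V h.succ))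
    (h : Fin (H + 1)) : V h ≤ stateValue π ℓ P h := by
  induction h using Fin.reverseInduction with
  | last => rwa [stateValue_last]
  | cast h ih =>
    rw [stateValue_castSucc]
    exact (hstep h).trans (bellman_mono (fun s a => (hP h s a).1) (fun s => (hπ h s).1) ih)

theorem stateValue_mem_Icc (hP : IsKernel P) (hπ : IsPolicy π)
    (hℓ : ∀ h s a, ℓ h s a ∈ Set.Icc 0 1) (h : Fin (H + 1)) (s : S) :
    stateValue π ℓ P h s ∈ Set.Icc 0 ((H : ℝ) - h) := by
  induction h using Fin.reverseInduction generalizing s with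
  | last => simp [stateValue_last]
  | cast h ih =>
    rw [stateValue_castSucc]
    refine dotProduct_mem_Icc (hπ h s) fun a => ?_
    have hnext := dotProduct_mem_Icc (hP h s a) ih
    have hloss := hℓ h s a
    simp only [Fin.val_succ, Fin.val_castSucc, Nat.cast_add, Nat.cast_one, Set.mem_Icc]
      at hnext hloss ⊢
    constructor <;> linarith

theorem stateValue_succ {π ℓ : Fin (H + 1) → S → A → ℝ} {P : Fin (H + 1) → S → A → S → ℝ}
    (h : Fin (H + 1)) :
    stateValue π ℓ P h.succ = stateValue (Fin.tail π) (Fin.tail ℓ) (Fin.tail P) h := by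
  induction h using Fin.reverseInduction with
  | last => rw [Fin.succ_last, stateValue_last, stateValue_last]
  | cast h ih => rw [Fin.succ_castSucc, stateValue_castSucc, stateValue_castSucc, ih]; rfl

theorem sum_traj_succ (F : Traj S A (H + 1) → ℝ) :
    ∑ τ, F τ = ∑ s, ∑ a, ∑ τ : Traj S A H,
      F ((Fin.cons s τ.1 : Fin (H + 2) → S), (Fin.cons a τ.2 : Fin (H + 1) → A)) := by
  rw [Fintype.sum_prod_type, ← (Fin.consEquiv fun _ : Fin (H + 2) => S).sum_comp,
    Fintype.sum_prod_type]
  refine Finset.sum_congr rfl fun s _ => ?_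
  simp_rw [← (Fin.consEquiv fun _ : Fin (H + 1) => A).sum_comp, Fintype.sum_prod_type]
  rw [Finset.sum_comm]
  rfl

theorem sum_trajProb_zero (p : S → ℝ) (P : Fin 0 → S → A → S → ℝ) (π : Fin 0 → S → A → ℝ) :
    ∑ τ, trajProb p P π τ = ∑ s, p s := by
  rw [Fintype.sum_prod_type]
  simp only [trajProb, Finset.univ_eq_empty, Finset.prod_empty, mul_one, Finset.sum_const,
    Finset.card_univ, Fintype.card_unique, one_smul]
  exact (Equiv.funUnique (Fin 1) S).sum_comp p

theorem sum_trajProb_succ (p : S → ℝ) (P : Fin (H + 1) → S → A → S → ℝ)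
    (π : Fin (H + 1) → S → A → ℝ) :
    ∑ τ, trajProb p P π τ
      = p ⬝ᵥ fun s => π 0 s ⬝ᵥ fun a => ∑ τ, trajProb (P 0 s a) (Fin.tail P) (Fin.tail π) τ := by
  rw [sum_traj_succ]
  simp_rw [trajProb_cons, ← Finset.mul_sum]
  rfl

theorem sum_trajProb (p : S → ℝ) (hP : IsKernel P) (hπ : IsPolicy π) :
    ∑ τ, trajProb p P π τ = ∑ s, p s := by
  induction H generalizing p with
  | zero => exact sum_trajProb_zero p P π
  | succ H ih =>
    have htail (s : S) (a : A) : ∑ τ, trajProb (P 0 s a) (Fin.tail P) (Fin.tail π) τ = 1 :=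
      (ih (P 0 s a) (fun h => hP h.succ) fun h => hπ h.succ).trans (hP 0 s a).2
    simp_rw [sum_trajProb_succ, htail, dotProduct_const_of_mem_stdSimplex (hπ 0 _), dotProduct,
      mul_one]

theorem sum_trajProb_le {p : S → ℝ} (hp : 0 ≤ p) (hP : ∀ h s a, 0 ≤ P h s a)
    (hP1 : ∀ h s a, ∑ s', P h s a s' ≤ 1) (hπ : IsPolicy π) :
    ∑ τ, trajProb p P π τ ≤ ∑ s, p s := by
  induction H generalizing p with
  | zero => exact (sum_trajProb_zero p P π).le
  | succ H ih =>
    have htail (s : S) (a : A) : ∑ τ, trajProb (P 0 s a) (Fin.tail P) (Fin.tail π) τ ≤ 1 :=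
      (ih (hP 0 s a) (fun h => hP h.succ) (fun h => hP1 h.succ) fun h => hπ h.succ).trans
        (hP1 0 s a)
    rw [sum_trajProb_succ]
    refine Finset.sum_le_sum fun s _ => mul_le_of_le_one_right (hp s) ?_
    exact (dotProduct_le_dotProduct_of_nonneg_left (htail s) (hπ 0 s).1).trans_eq
      (dotProduct_const_of_mem_stdSimplex (hπ 0 s) 1)

theorem value_succ (p : S → ℝ) {π : Fin (H + 1) → S → A → ℝ} (ℓ : Fin (H + 1) → S → A → ℝ)
    {P : Fin (H + 1) → S → A → S → ℝ} (hP : IsKernel P) (hπ : IsPolicy π) :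
    value p π ℓ P = p ⬝ᵥ fun s => π 0 s ⬝ᵥ fun a =>
      ℓ 0 s a + value (P 0 s a) (Fin.tail π) (Fin.tail ℓ) (Fin.tail P) := by
  have hmass (s : S) (a : A) : ∑ τ, trajProb (P 0 s a) (Fin.tail P) (Fin.tail π) τ = 1 :=
    (sum_trajProb _ (fun h => hP h.succ) fun h => hπ h.succ).trans (hP 0 s a).2
  rw [value, sum_traj_succ]
  simp_rw [trajProb_cons, Fin.sum_univ_succ, Fin.cons_zero, Fin.cons_succ, Fin.castSucc_zero,
    ← Fin.succ_castSucc, Fin.cons_zero, Fin.cons_succ, mul_assoc, ← Finset.mul_sum, mul_add,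
    Finset.sum_add_distrib, ← Finset.sum_mul, hmass, one_mul]
  simp only [dotProduct, value, Fin.tail, mul_add, Finset.sum_add_distrib]

theorem value_eq_dotProduct (p : S → ℝ) (ℓ : Fin H → S → A → ℝ) (hP : IsKernel P)
    (hπ : IsPolicy π) : value p π ℓ P = p ⬝ᵥ stateValue π ℓ P 0 := by
  induction H generalizing p with
  | zero =>
    have hzero : stateValue π ℓ P 0 = 0 := stateValue_last
    simp [value, hzero]
  | succ H ih =>
    have hrec : stateValue π ℓ P 0 = bellman (π 0) (ℓ 0) (P 0)
        (stateValue (Fin.tail π) (Fin.tail ℓ) (Fin.tail P) 0) := by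
      rw [← stateValue_succ, ← stateValue_castSucc, Fin.castSucc_zero]
    rw [value_succ p ℓ hP hπ, hrec]
    simp only [ih _ _ (P := Fin.tail P) (π := Fin.tail π) (fun h => hP h.succ) fun h => hπ h.succ]
    rfl

theorem value_mono {p : S → ℝ} (hp : 0 ≤ p) (hP : IsKernel P) (hπ : IsPolicy π)
    (hℓ : ∀ h s a, ℓ h s a ≤ ℓ' h s a) : value p π ℓ P ≤ value p π ℓ' P :=
  Finset.sum_le_sum fun τ _ => mul_le_mul_of_nonneg_left (Finset.sum_le_sum fun h _ => hℓ h _ _)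
    (trajProb_nonneg hp (fun h s a => (hP h s a).1) (fun h s => (hπ h s).1) τ)

theorem value_add (p : S → ℝ) (π ℓ ℓ' : Fin H → S → A → ℝ) (P : Fin H → S → A → S → ℝ) :
    value p π (ℓ + ℓ') P = value p π ℓ P + value p π ℓ' P := by
  simp only [value, Pi.add_apply, Finset.sum_add_distrib, mul_add]

theorem value_smul (p : S → ℝ) (π : Fin H → S → A → ℝ) (c : ℝ) (ℓ : Fin H → S → A → ℝ)
    (P : Fin H → S → A → S → ℝ) : value p π (c • ℓ) P = c * value p π ℓ P := by
  simp only [value, Pi.smul_apply, smul_eq_mul, ← Finset.mul_sum, mul_left_comm _ c]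

theorem value_const {p : S → ℝ} (hp : p ∈ stdSimplex ℝ S) (hP : IsKernel P) (hπ : IsPolicy π)
    (c : ℝ) : value p π (fun _ _ _ => c) P = H * c := by
  simp only [value, Finset.sum_const, Finset.card_univ, Fintype.card_fin, nsmul_eq_mul,
    ← Finset.sum_mul, sum_trajProb p hP hπ, hp.2, one_mul]

end Values

section Perturbation

variable {S A : Type*} [Fintype S] [Fintype A] {H : ℕ} {p : S → ℝ}
  {π g x : Fin H → S → A → ℝ} {P Q : Fin H → S → A → S → ℝ} {α β c lam γ : ℝ}

/-- The variance of the value of the next state, under the transition of step `h` from `(s, a)`. -/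
def stepVariance (π g : Fin H → S → A → ℝ) (Q : Fin H → S → A → S → ℝ) (h : Fin H) (s : S) (a : A) :
    ℝ :=
  weightedVariance (Q h s a) (stateValue π g Q h.succ)

-- The potential `V (2 H - V)` drops along each step by at least the variance of that step.
theorem value_stepVariance_le_sq (hp : p ∈ stdSimplex ℝ S) (hQ : IsKernel Q) (hπ : IsPolicy π)
    (hg : ∀ h s a, g h s a ∈ Set.Icc 0 1) :
    value p π (stepVariance π g Q) Q ≤ (H : ℝ) ^ 2 := by
  let V := stateValue π g Q
  let D (h : Fin (H + 1)) (s : S) : ℝ := V h s * (2 * H - V h s)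
  have hstep (h : Fin H) :
      bellman (π h) (stepVariance π g Q h) (Q h) (D h.succ) ≤ D h.castSucc := by
    intro s
    have hnext (a : A) : stepVariance π g Q h s a + Q h s a ⬝ᵥ D h.succ
        ≤ (g h s a + Q h s a ⬝ᵥ V h.succ) * (2 * H - (g h s a + Q h s a ⬝ᵥ V h.succ)) := by
      have hV := dotProduct_mem_Icc (hQ h s a) (stateValue_mem_Icc hQ hπ hg h.succ)
      have hgap : 0 ≤ g h s a * (2 * H - g h s a - 2 * (Q h s a ⬝ᵥ V h.succ)) := by
        refine mul_nonneg (hg h s a).1 ?_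
        have hle := hV.2
        push_cast [Fin.val_succ] at hle
        linarith [(hg h s a).2, (h : ℕ).cast_nonneg (α := ℝ)]
      calc stepVariance π g Q h s a + Q h s a ⬝ᵥ D h.succ
          = (Q h s a ⬝ᵥ V h.succ) * (2 * H - Q h s a ⬝ᵥ V h.succ) :=
            weightedVariance_add_dotProduct_mul_sub (hQ h s a) (V h.succ) (2 * H)
        _ ≤ _ := by linarith
    calc bellman (π h) (stepVariance π g Q h) (Q h) (D h.succ) s
        ≤ _ := dotProduct_le_dotProduct_of_nonneg_left hnext (hπ h s).1
      _ ≤ _ := dotProduct_mul_sub_le (hπ h s) _ _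
      _ = D h.castSucc s := by simp only [D, V, stateValue_castSucc, bellman]
  have hlast : 0 ≤ D (Fin.last H) := fun s => by simp [D, V, stateValue_last]
  have hD (s : S) : D 0 s ≤ (H : ℝ) ^ 2 := by linarith [sq_nonneg (H - V 0 s)]
  calc value p π (stepVariance π g Q) Q = p ⬝ᵥ stateValue π (stepVariance π g Q) Q 0 :=
        value_eq_dotProduct p _ hQ hπ
    _ ≤ p ⬝ᵥ fun _ => (H : ℝ) ^ 2 := dotProduct_le_dotProduct_of_nonneg_left
        ((stateValue_le hQ hπ hlast hstep 0).trans hD) hp.1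
    _ = (H : ℝ) ^ 2 := dotProduct_const_of_mem_stdSimplex hp _

theorem abs_bellman_sub_bellman_le {π : S → A → ℝ} {s : S} (hπ : 0 ≤ π s) (ℓ : S → A → ℝ)
    (P Q : S → A → S → ℝ) (u v : S → ℝ) :
    |bellman π ℓ P u s - bellman π ℓ Q v s| ≤ π s ⬝ᵥ fun a => |P s a ⬝ᵥ u - Q s a ⬝ᵥ v| := by
  rw [bellman, bellman, ← dotProduct_sub]
  refine (abs_dotProduct_le hπ _).trans_eq (congrArg (π s ⬝ᵥ ·) (funext fun a => ?_))
  simp only [Pi.abs_apply, Pi.sub_apply, add_sub_add_left_eq_sub]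

-- Discounting the gap at step `h` by `γ ^ h` absorbs the factor `γ` lost in each step.
theorem abs_value_sub_le_of_step (hp : 0 ≤ p) (hP : IsKernel P) (hQ : IsKernel Q) (hπ : IsPolicy π)
    (hγ : 1 ≤ γ) {b : Fin H → S → A → ℝ} (hb : 0 ≤ b)
    (hstep : ∀ h s a, |P h s a ⬝ᵥ stateValue π g P h.succ - Q h s a ⬝ᵥ stateValue π g Q h.succ|
      ≤ b h s a + γ * (Q h s a ⬝ᵥ |stateValue π g P h.succ - stateValue π g Q h.succ|)) :
    |value p π g P - value p π g Q| ≤ γ ^ H * value p π b Q := by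
  let W (h : Fin (H + 1)) : S → ℝ := γ ^ (h : ℕ) • |stateValue π g P h - stateValue π g Q h|
  have : 0 ≤ γ := zero_le_one.trans hγ
  have hlast : W (Fin.last H) ≤ 0 := fun s => by simp [W, stateValue_last]
  have hW (h : Fin H) : W h.castSucc ≤ bellman (π h) ((γ ^ H • b) h) (Q h) (W h.succ) := by
    intro s
    calc W h.castSucc s
        ≤ γ ^ (h : ℕ) * (π h s ⬝ᵥ fun a => |P h s a ⬝ᵥ stateValue π g P h.succ
          - Q h s a ⬝ᵥ stateValue π g Q h.succ|) := by
          simp only [W, stateValue_castSucc, Pi.smul_apply, Pi.abs_apply, Pi.sub_apply,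
            smul_eq_mul, Fin.val_castSucc]
          gcongr
          exact abs_bellman_sub_bellman_le (hπ h s).1 ..
      _ = π h s ⬝ᵥ (γ ^ (h : ℕ) • fun a => |P h s a ⬝ᵥ stateValue π g P h.succ
          - Q h s a ⬝ᵥ stateValue π g Q h.succ|) := by
          rw [dotProduct_smul, smul_eq_mul]
      _ ≤ _ := dotProduct_le_dotProduct_of_nonneg_left (fun a => ?_) (hπ h s).1
    calc γ ^ (h : ℕ) * |P h s a ⬝ᵥ stateValue π g P h.succ - Q h s a ⬝ᵥ stateValue π g Q h.succ|
        ≤ γ ^ (h : ℕ) * (b h s a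
          + γ * (Q h s a ⬝ᵥ |stateValue π g P h.succ - stateValue π g Q h.succ|)) := by
          gcongr
          exact hstep h s a
      _ = γ ^ (h : ℕ) * b h s a + Q h s a ⬝ᵥ W h.succ := by
          simp only [W, dotProduct_smul, Fin.val_succ, smul_eq_mul]
          ring
      _ ≤ γ ^ H * b h s a + Q h s a ⬝ᵥ W h.succ := by
          gcongr
          exacts [hb h s a, h.is_lt.le]
  calc |value p π g P - value p π g Q|
      = |p ⬝ᵥ (stateValue π g P 0 - stateValue π g Q 0)| := by
        rw [value_eq_dotProduct p g hP hπ, value_eq_dotProduct p g hQ hπ, dotProduct_sub]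
    _ ≤ p ⬝ᵥ W 0 := (abs_dotProduct_le hp _).trans_eq (by simp [W])
    _ ≤ p ⬝ᵥ stateValue π (γ ^ H • b) Q 0 := dotProduct_le_dotProduct_of_nonneg_left
        (le_stateValue hQ hπ hlast hW 0) hp
    _ = γ ^ H * value p π b Q := by rw [← value_smul, value_eq_dotProduct p _ hQ hπ]

theorem abs_value_sub_le (hp : p ∈ stdSimplex ℝ S) (hP : IsKernel P) (hQ : IsKernel Q)
    (hπ : IsPolicy π) (hg : ∀ h s a, g h s a ∈ Set.Icc 0 1) (hx : ∀ h s a, 0 ≤ x h s a)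
    (hβ : 0 ≤ β) (hc : 0 < c) (hlam : 0 < lam)
    (hPQ : ∀ h s a s', |P h s a s' - Q h s a s'| ≤ α * √(Q h s a s' * x h s a) + β * x h s a) :
    |value p π g P - value p π g Q|
      ≤ value p π (fun h s a => (1 + lam) ^ H * (c * H + Fintype.card S *
          (α ^ 2 / (4 * c) + H * (2 * β + α ^ 2 / (4 * lam))) * x h s a)) Q := by
  set C : ℝ := Fintype.card S * (α ^ 2 / (4 * c) + H * (2 * β + α ^ 2 / (4 * lam)))
  have hmem {R : Fin H → S → A → S → ℝ} (hR : IsKernel R) (h : Fin (H + 1)) (s : S) :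
      stateValue π g R h s ∈ Set.Icc 0 (H : ℝ) :=
    Set.Icc_subset_Icc_right (sub_le_self _ (Nat.cast_nonneg _)) (stateValue_mem_Icc hR hπ hg h s)
  have hC : 0 ≤ C := by positivity
  have hb : 0 ≤ c • stepVariance π g Q + C • x := fun h s a =>
    add_nonneg (mul_nonneg hc.le (weightedVariance_nonneg (hQ h s a).1 _))
      (mul_nonneg hC (hx h s a))
  have hsim := abs_value_sub_le_of_step hp.1 hP hQ hπ (le_add_of_nonneg_right hlam.le) hb
    fun h s a => abs_dotProduct_sub_dotProduct_le (hP h s a) (hQ h s a) (hx h s a) hβ hc hlam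
      (hPQ h s a) (hmem hP h.succ) (hmem hQ h.succ)
  calc |value p π g P - value p π g Q|
      ≤ (1 + lam) ^ H * (c * value p π (stepVariance π g Q) Q + C * value p π x Q) := by
        rwa [value_add, value_smul, value_smul] at hsim
    _ ≤ (1 + lam) ^ H * (c * (H : ℝ) ^ 2 + C * value p π x Q) := by
        gcongr
        exact value_stepVariance_le_sq hp hQ hπ hg
    _ = (1 + lam) ^ H * (value p π (fun _ _ _ => c * H) Q + value p π (C • x) Q) := by
        rw [value_const hp hQ hπ, value_smul]
        ring
    _ = _ := by rw [← value_add, ← value_smul]; rfl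

end Perturbation

section FiniteConditioning

variable {Ω β : Type*} {m mΩ : MeasurableSpace Ω} {μ : Measure Ω} {Y : Ω → β}

theorem measurable_comp_of_finite [Finite β] (hY : ∀ b, MeasurableSet[m] (Y ⁻¹' {b}))
    (z : β → ℝ) : Measurable[m] fun ω => z (Y ω) := by
  let _ : MeasurableSpace β := ⊤
  exact (measurable_from_top (f := z)).comp (measurable_to_countable' hY)

theorem condExp_comp_of_finite [Fintype β] [IsFiniteMeasure μ]
    (hY : ∀ b, MeasurableSet (Y ⁻¹' {b})) (z : β → ℝ) :
    μ[fun ω => z (Y ω) | m] =ᵐ[μ] ∑ b, z b • μ[(Y ⁻¹' {b}).indicator (fun _ => (1 : ℝ)) | m] := by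
  classical
  have hdecomp : (fun ω => z (Y ω))
      = ∑ b, z b • (Y ⁻¹' {b}).indicator fun _ => (1 : ℝ) := by
    ext ω
    simp [Set.indicator_apply]
  have hint (b : β) : Integrable ((Y ⁻¹' {b}).indicator fun _ => (1 : ℝ)) μ :=
    (integrable_const 1).indicator (hY b)
  rw [hdecomp]
  exact (condExp_finsetSum (fun b _ => (hint b).smul (z b)) m).trans
    (eventuallyEq_sum fun b _ => condExp_smul (z b) _ m)

theorem integrable_prod_of_le {ι : Type*} [IsFiniteMeasure μ] {Z : ι → Ω → ℝ} {C : ι → ℝ}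
    (hZ0 : ∀ i, 0 ≤ Z i) (hZC : ∀ i ω, Z i ω ≤ C i) (hZm : ∀ i, Measurable (Z i))
    (J : Finset ι) : Integrable (fun ω => ∏ j ∈ J, Z j ω) μ :=
  Integrable.of_mem_Icc 0 (∏ j ∈ J, C j)
    (Finset.measurable_fun_prod J fun j _ => hZm j).aemeasurable <| ae_of_all _ fun ω =>
      ⟨Finset.prod_nonneg fun j _ => hZ0 j ω,
        Finset.prod_le_prod (fun j _ => hZ0 j ω) fun j _ => hZC j ω⟩

theorem integral_prod_le_one {ι : Type*} [LinearOrder ι] [IsProbabilityMeasure μ]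
    (ℱ : Filtration ι mΩ) {Z : ι → Ω → ℝ} {C : ι → ℝ} (hZ0 : ∀ i, 0 ≤ Z i)
    (hZC : ∀ i ω, Z i ω ≤ C i) (hZm : ∀ i, Measurable (Z i))
    (hZℱ : ∀ i j, i < j → Measurable[ℱ j] (Z i)) (hcond : ∀ i, μ[Z i | ℱ i] ≤ᵐ[μ] 1)
    (J : Finset ι) : ∫ ω, ∏ j ∈ J, Z j ω ∂μ ≤ 1 := by
  have hint (J : Finset ι) : Integrable (fun ω => ∏ j ∈ J, Z j ω) μ :=
    integrable_prod_of_le hZ0 hZC hZm J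
  induction J using Finset.induction_on_max with
  | empty => simp
  | insert k J hJ ih =>
    have hk : k ∉ J := fun hk => (hJ k hk).false
    let W : Ω → ℝ := fun ω => ∏ j ∈ J, Z j ω
    have hW : Measurable[ℱ k] W := Finset.measurable_fun_prod J fun j hj => hZℱ j k (hJ j hj)
    have hprod : (fun ω => ∏ j ∈ insert k J, Z j ω) = W * Z k := by
      ext ω
      rw [Finset.prod_insert hk, mul_comm, Pi.mul_apply]
    have hZk : Integrable (Z k) μ := by simpa using hint {k}
    have hWZ : Integrable (W * Z k) μ := hprod ▸ hint (insert k J)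
    have hpull : μ[W * Z k | ℱ k] =ᵐ[μ] W * μ[Z k | ℱ k] :=
      condExp_mul_of_stronglyMeasurable_left hW.stronglyMeasurable hWZ hZk
    calc ∫ ω, ∏ j ∈ insert k J, Z j ω ∂μ
        = ∫ ω, (μ[W * Z k | ℱ k]) ω ∂μ := by rw [hprod, integral_condExp (ℱ.le k)]
      _ ≤ ∫ ω, W ω ∂μ := by
          refine integral_mono_ae integrable_condExp (hint J) ?_
          filter_upwards [hpull, hcond k] with ω hω hle
          rw [hω]
          exact mul_le_of_le_one_right (Finset.prod_nonneg fun j _ => hZ0 j ω) hle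
      _ ≤ 1 := ih

theorem IsLearningRun.integrable_prod_and_integral_le_one {S A : Type*} [Fintype S] [Fintype A]
    {H K : ℕ} {p : S → ℝ} {P : Fin H → S → A → S → ℝ} {ℱ : Filtration (Fin K) mΩ}
    {π : Fin K → Ω → Fin H → S → A → ℝ} {X : Fin K → Ω → Traj S A H} [IsProbabilityMeasure μ]
    (hrun : IsLearningRun μ p P ℱ π X) {z : Traj S A H → ℝ} (hz0 : ∀ τ, 0 ≤ z τ)
    (hz : ∀ ρ, IsPolicy ρ → ∑ τ, trajProb p P ρ τ * z τ ≤ 1) (J : Finset (Fin K)) :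
    Integrable (fun ω => ∏ j ∈ J, z (X j ω)) μ ∧ ∫ ω, ∏ j ∈ J, z (X j ω) ∂μ ≤ 1 := by
  have hZ0 (j : Fin K) : 0 ≤ fun ω => z (X j ω) := fun ω => hz0 _
  have hZC (j : Fin K) (ω : Ω) : z (X j ω) ≤ ∑ τ, z τ :=
    Finset.single_le_sum (fun τ _ => hz0 τ) (Finset.mem_univ (X j ω))
  have hZm (j : Fin K) : Measurable fun ω => z (X j ω) :=
    measurable_comp_of_finite (hrun.traj_measurable j) z
  have hcond (j : Fin K) : μ[fun ω => z (X j ω) | ℱ j] ≤ᵐ[μ] 1 := by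
    filter_upwards [condExp_comp_of_finite (m := ℱ j) (hrun.traj_measurable j) z,
      ae_all_iff.2 (hrun.traj_law j)] with ω hω hlaw
    rw [hω, Finset.sum_apply]
    simp only [Pi.smul_apply, hlaw, smul_eq_mul, mul_comm (z _)]
    exact hz _ (hrun.isPolicy j ω)
  exact ⟨integrable_prod_of_le hZ0 hZC hZm J, integral_prod_le_one ℱ hZ0 hZC hZm
    (fun i j hij => measurable_comp_of_finite (fun τ => hrun.past_measurable i j τ hij) z) hcond J⟩

end FiniteConditioning

section Concentration

theorem dotProduct_exp_le_one {ι : Type*} [Fintype ι] [DecidableEq ι] {q : ι → ℝ}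
    (hq : q ∈ stdSimplex ℝ ι) (j : ι) {t : ℝ} (ht : |t| ≤ 1) :
    (q ⬝ᵥ fun i => Real.exp (t * ((if i = j then 1 else 0) - q j) - t ^ 2 * q j)) ≤ 1 := by
  have hmgf : (q ⬝ᵥ fun i => Real.exp (t * if i = j then 1 else 0))
      = 1 + q j * (Real.exp t - 1) := by
    have hterm (i : ι) : q i * Real.exp (t * if i = j then 1 else 0)
        = q i + if i = j then q i * (Real.exp t - 1) else 0 := by
      split_ifs
      · ring_nf
      · simp
    simp_rw [dotProduct, hterm, Finset.sum_add_distrib, hq.2, Finset.sum_ite_eq',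
      Finset.mem_univ, if_true]
  have hexp : Real.exp t - 1 - t ≤ t ^ 2 := (abs_le.1 (Real.abs_exp_sub_one_sub_id_le ht)).2
  calc (q ⬝ᵥ fun i => Real.exp (t * ((if i = j then 1 else 0) - q j) - t ^ 2 * q j))
      = (q ⬝ᵥ fun i => Real.exp (t * if i = j then 1 else 0))
          * Real.exp (-(t * q j) - t ^ 2 * q j) := by
        rw [dotProduct, dotProduct, Finset.sum_mul]
        refine Finset.sum_congr rfl fun i _ => ?_
        rw [mul_assoc, ← Real.exp_add]
        ring_nf
    _ ≤ Real.exp (q j * (Real.exp t - 1)) * Real.exp (-(t * q j) - t ^ 2 * q j) := by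
        rw [hmgf, add_comm]
        gcongr
        exact Real.add_one_le_exp _
    _ = Real.exp (q j * (Real.exp t - 1 - t - t ^ 2)) := by rw [← Real.exp_add]; ring_nf
    _ ≤ 1 := Real.exp_le_one_iff.2 (mul_nonpos_of_nonneg_of_nonpos (hq.1 j) (by linarith))

variable {S A : Type*} {H K : ℕ} {P : Fin H → S → A → S → ℝ}

-- Multiplying the rows of step `h` by `f` turns the weighted sum into the total mass of the
-- trajectories of a substochastic kernel.
theorem sum_trajProb_mul_le_one [Fintype S] [Fintype A] {p : S → ℝ} (hp : p ∈ stdSimplex ℝ S)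
    (hP : IsKernel P) {π : Fin H → S → A → ℝ} (hπ : IsPolicy π) (h : Fin H) {f : S → A → S → ℝ}
    (hf : ∀ s a, 0 ≤ f s a) (hPf : ∀ s a, P h s a ⬝ᵥ f s a ≤ 1) :
    ∑ τ, trajProb p P π τ * f (τ.1 h.castSucc) (τ.2 h) (τ.1 h.succ) ≤ 1 := by
  let P' (i : Fin H) (s : S) (a : A) (s' : S) : ℝ := P i s a s' * if i = h then f s a s' else 1
  have htilt (τ : Traj S A H) :
      trajProb p P π τ * f (τ.1 h.castSucc) (τ.2 h) (τ.1 h.succ) = trajProb p P' π τ := by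
    rw [← Fintype.prod_ite_eq' h fun i => f (τ.1 i.castSucc) (τ.2 i) (τ.1 i.succ), trajProb,
      trajProb, mul_assoc, ← Finset.prod_mul_distrib]
    simp only [P', mul_assoc]
  have hP'0 (i : Fin H) (s : S) (a : A) : 0 ≤ P' i s a := fun s' => by
    refine mul_nonneg ((hP i s a).1 s') ?_
    split_ifs
    exacts [hf s a s', zero_le_one]
  have hP'1 (i : Fin H) (s : S) (a : A) : ∑ s', P' i s a s' ≤ 1 := by
    rcases eq_or_ne i h with rfl | hi
    · simpa [P', dotProduct] using hPf s a
    · simp [P', hi, (hP i s a).2]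
  simp_rw [htilt]
  exact (sum_trajProb_le hp.1 hP'0 hP'1 hπ).trans_eq hp.2

variable [DecidableEq S] [DecidableEq A]

/-- The factor a transition contributes to the exponential supermartingale that controls the
counts of `(s, a, s')`; it is `1` away from `(s, a)`, and `q` stands for the probability of
moving from `(s, a)` to `s'`. -/
noncomputable def transitionWeight (s : S) (a : A) (s' : S) (q t : ℝ) (u : S) (b : A) (u' : S) :
    ℝ :=
  if u = s ∧ b = a then Real.exp (t * ((if u' = s' then 1 else 0) - q) - t ^ 2 * q) else 1

theorem transitionWeight_nonneg (s : S) (a : A) (s' : S) (q t : ℝ) (u : S) (b : A) :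
    0 ≤ transitionWeight s a s' q t u b := fun u' => by
  rw [transitionWeight, Pi.zero_apply]
  positivity

theorem dotProduct_transitionWeight_le_one [Fintype S] (hP : IsKernel P) (h : Fin H) (s : S)
    (a : A) (s' : S) {t : ℝ} (ht : |t| ≤ 1) (u : S) (b : A) :
    P h u b ⬝ᵥ transitionWeight s a s' (P h s a s') t u b ≤ 1 := by
  by_cases hub : u = s ∧ b = a
  · obtain ⟨rfl, rfl⟩ := hub
    simpa [transitionWeight, dotProduct] using dotProduct_exp_le_one (hP h u b) s' ht
  · have hone : transitionWeight s a s' (P h s a s') t u b = fun _ => 1 :=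
      funext fun _ => if_neg hub
    rw [hone, dotProduct_const_of_mem_stdSimplex (hP h u b)]

theorem prod_transitionWeight (x : Fin K → Traj S A H) (k : Fin K) (h : Fin H) (s : S) (a : A)
    (s' : S) (q t : ℝ) :
    ∏ j ∈ Finset.Iio k,
        transitionWeight s a s' q t ((x j).1 h.castSucc) ((x j).2 h) ((x j).1 h.succ)
      = Real.exp (t * (transitions x k h s a s' - visits x k h s a * q)
          - t ^ 2 * (visits x k h s a * q)) := by
  have hfilter : (Finset.Iio k).filter (fun j => (x j).1 h.castSucc = s ∧ (x j).2 h = a)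
      = Finset.univ.filter fun j => j < k ∧ (x j).1 h.castSucc = s ∧ (x j).2 h = a := by
    ext j
    simp
  simp only [transitionWeight, ← Finset.prod_filter, ← Real.exp_sum, Finset.sum_sub_distrib,
    ← Finset.mul_sum, Finset.sum_const, nsmul_eq_mul, Finset.sum_boole, hfilter,
    Finset.filter_filter, and_assoc]
  rfl

variable [Fintype S] [Fintype A] {Ω : Type*} {mΩ : MeasurableSpace Ω} {μ : Measure Ω}
  [IsProbabilityMeasure μ] {p : S → ℝ} {ℱ : Filtration (Fin K) mΩ}
  {π : Fin K → Ω → Fin H → S → A → ℝ} {X : Fin K → Ω → Traj S A H}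

theorem measureReal_le_exp_neg (hp : p ∈ stdSimplex ℝ S) (hP : IsKernel P)
    (hrun : IsLearningRun μ p P ℱ π X) (k : Fin K) (h : Fin H) (s : S) (a : A) (s' : S)
    {t : ℝ} (ht : |t| ≤ 1) (y : ℝ) :
    μ.real {ω | y ≤ t * (transitions (fun j => X j ω) k h s a s'
        - visits (fun j => X j ω) k h s a * P h s a s')
          - t ^ 2 * (visits (fun j => X j ω) k h s a * P h s a s')} ≤ Real.exp (-y) := by
  let Y (ω : Ω) : ℝ := t * (transitions (fun j => X j ω) k h s a s'
    - visits (fun j => X j ω) k h s a * P h s a s')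
      - t ^ 2 * (visits (fun j => X j ω) k h s a * P h s a s')
  obtain ⟨hint, hmean⟩ := hrun.integrable_prod_and_integral_le_one
    (z := fun τ => transitionWeight s a s' (P h s a s') t (τ.1 h.castSucc) (τ.2 h) (τ.1 h.succ))
    (fun τ => transitionWeight_nonneg s a s' _ t _ _ _)
    (fun ρ hρ => sum_trajProb_mul_le_one hp hP hρ h (transitionWeight_nonneg s a s' _ t)
      (dotProduct_transitionWeight_le_one hP h s a s' ht)) (Finset.Iio k)
  have hprod (ω : Ω) : ∏ j ∈ Finset.Iio k, transitionWeight s a s' (P h s a s') t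
      ((X j ω).1 h.castSucc) ((X j ω).2 h) ((X j ω).1 h.succ) = Real.exp (1 * Y ω) :=
    (prod_transitionWeight (fun j => X j ω) k h s a s' (P h s a s') t).trans (by rw [one_mul])
  simp_rw [hprod] at hint hmean
  calc μ.real {ω | y ≤ Y ω} ≤ Real.exp (-1 * y) * mgf Y μ 1 :=
        measure_ge_le_exp_mul_mgf y zero_le_one hint
    _ ≤ Real.exp (-1 * y) * 1 := by gcongr; exact hmean
    _ = Real.exp (-y) := by rw [mul_one, neg_one_mul]

theorem exists_chernoff_parameter {v y : ℝ} (hv : 0 ≤ v) (hy : 0 ≤ y) :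
    ∃ t ∈ Set.Icc (0 : ℝ) 1, y ≤ t * (2 * √(v * y) + y) - t ^ 2 * v := by
  rcases le_or_gt v y with hvy | hyv
  · refine ⟨1, ⟨zero_le_one, le_rfl⟩, ?_⟩
    have hsqrt : v ≤ √(v * y) := Real.le_sqrt_of_sq_le (by nlinarith)
    linarith [Real.sqrt_nonneg (v * y)]
  · have hv0 : 0 < v := hy.trans_lt hyv
    refine ⟨√(y / v), ⟨Real.sqrt_nonneg _, Real.sqrt_le_one.2 ((div_le_one hv0).2 hyv.le)⟩, ?_⟩
    have hmul : √(y / v) * √(v * y) = y := by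
      rw [← Real.sqrt_mul (by positivity), ← mul_assoc, div_mul_cancel₀ _ hv0.ne',
        Real.sqrt_mul_self hy]
    have hsq : √(y / v) ^ 2 * v = y := by
      rw [Real.sq_sqrt (by positivity), div_mul_cancel₀ _ hv0.ne']
    linarith [mul_nonneg (Real.sqrt_nonneg (y / v)) hy]

theorem measureReal_visits_eq_and_le (hp : p ∈ stdSimplex ℝ S) (hP : IsKernel P)
    (hrun : IsLearningRun μ p P ℱ π X) (k : Fin K) (h : Fin H) (s : S) (a : A) (s' : S) (n : ℕ)
    {y σ : ℝ} (hy : 0 ≤ y) (hσ : |σ| = 1) :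
    μ.real {ω | visits (fun j => X j ω) k h s a = n ∧ 2 * √(n * P h s a s' * y) + y
        ≤ σ * (transitions (fun j => X j ω) k h s a s' - n * P h s a s')} ≤ Real.exp (-y) := by
  have hv : 0 ≤ n * P h s a s' := mul_nonneg n.cast_nonneg ((hP h s a).1 s')
  obtain ⟨t, ⟨ht0, ht1⟩, ht⟩ := exists_chernoff_parameter hv hy
  have htσ : |t * σ| ≤ 1 := by rwa [abs_mul, hσ, mul_one, abs_of_nonneg ht0]
  refine (measureReal_mono ?_).trans (measureReal_le_exp_neg hp hP hrun k h s a s' htσ y)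
  rintro ω ⟨hvisits, hdev⟩
  have hσ2 : σ ^ 2 = 1 := by rw [← sq_abs, hσ, one_pow]
  simp only [Set.mem_ofPred_eq, hvisits, mul_pow, hσ2, mul_one]
  linarith [mul_le_mul_of_nonneg_left hdev ht0]

end Concentration

section LogTerm

variable {S A : Type*} [Fintype S] [Fintype A] {H K : ℕ} {δ : ℝ}

theorem logTerm_nonneg (hδ0 : 0 < δ) (hδ1 : δ ≤ 1) : 0 ≤ logTerm S A H K δ := by
  rw [logTerm]
  norm_cast
  rcases (H * Fintype.card S * Fintype.card A * K).eq_zero_or_pos with hm | hm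
  · simp [hm]
  · exact Real.log_nonneg ((one_le_div hδ0).2 (hδ1.trans (Nat.one_le_cast.2 hm)))

theorem one_le_logTerm [Nonempty S] [Nonempty A] (hH : 0 < H) (hK : 0 < K) (hδ0 : 0 < δ)
    (hδ : δ ≤ 1 / 3) : 1 ≤ logTerm S A H K δ := by
  have hcard : (1 : ℝ) ≤ H * Fintype.card S * Fintype.card A * K := by
    exact_mod_cast Nat.succ_le_of_lt (by positivity : 0 < H * Fintype.card S * Fintype.card A * K)
  rw [logTerm, Real.le_log_iff_exp_le (by positivity), le_div_iff₀ hδ0]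
  calc Real.exp 1 * δ ≤ 3 * (1 / 3) := by
        gcongr
        exact Real.exp_one_lt_three.le
    _ = 1 := by norm_num
    _ ≤ _ := hcard

theorem card_mul_exp_neg_two_mul_logTerm_le (hδ0 : 0 < δ) (hδ1 : δ ≤ 1) :
    (K ^ 2 * H * Fintype.card S ^ 2 * Fintype.card A) * Real.exp (-(2 * logTerm S A H K δ))
      ≤ δ := by
  let m : ℝ := H * Fintype.card S * Fintype.card A * K
  have hcard : (K ^ 2 * H * Fintype.card S ^ 2 * Fintype.card A : ℝ)
      = m * (K * Fintype.card S) := by ring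
  rcases eq_or_ne m 0 with hm | hm
  · simpa only [hcard, hm, zero_mul] using hδ0.le
  have hm0 : 0 < m := hm.symm.lt_of_le (by positivity)
  simp only [m, mul_ne_zero_iff, Nat.cast_ne_zero] at hm
  have hHA : (1 : ℝ) ≤ H * Fintype.card A := by
    exact_mod_cast Nat.one_le_iff_ne_zero.2 (mul_ne_zero hm.1.1.1 hm.1.2)
  have hle : K * Fintype.card S ≤ m := by
    calc (K * Fintype.card S : ℝ) ≤ H * Fintype.card A * (K * Fintype.card S) :=
          le_mul_of_one_le_left (by positivity) hHA
      _ = m := by ring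
  have hexp : Real.exp (-(2 * logTerm S A H K δ)) = (δ / m) ^ 2 := by
    rw [← mul_neg, ← Nat.cast_ofNat, Real.exp_nat_mul, Real.exp_neg, logTerm,
      Real.exp_log (div_pos hm0 hδ0), inv_div]
  calc (K ^ 2 * H * Fintype.card S ^ 2 * Fintype.card A) * Real.exp (-(2 * logTerm S A H K δ))
      ≤ m * m * (δ / m) ^ 2 := by
        rw [hcard, hexp]
        gcongr
    _ = δ * δ := by field_simp
    _ ≤ δ := mul_le_of_le_one_left hδ0.le hδ1

end LogTerm

section GoodEvent

variable {S A : Type*} [DecidableEq S] [DecidableEq A] {H K : ℕ}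

theorem visits_lt (x : Fin K → Traj S A H) (k : Fin K) (h : Fin H) (s : S) (a : A) :
    visits x k h s a < K := by
  calc visits x k h s a ≤ (Finset.Iio k).card :=
        Finset.card_le_card fun j hj => Finset.mem_Iio.2 (Finset.mem_filter.1 hj).2.1
    _ < K := by rw [Fin.card_Iio]; exact k.isLt

theorem transitions_le_visits (x : Fin K → Traj S A H) (k : Fin K) (h : Fin H) (s : S) (a : A)
    (s' : S) : transitions x k h s a s' ≤ visits x k h s a :=
  Finset.card_le_card <| Finset.monotone_filter_right _ fun _ _ hj => ⟨hj.1, hj.2.1, hj.2.2.1⟩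

theorem effVisits_pos (x : Fin K → Traj S A H) (k : Fin K) (h : Fin H) (s : S) (a : A) :
    0 < effVisits x k h s a :=
  lt_max_of_lt_left one_pos

/-- The deterministic event behind the theorem: every transition count is within a Bernstein-type
radius, with deviation parameter `2 L`, of the visit count times the transition probability. -/
def CountsConcentrate (P : Fin H → S → A → S → ℝ) (L : ℝ) (x : Fin K → Traj S A H) : Prop :=
  ∀ k h s a s', |(transitions x k h s a s' : ℝ) - visits x k h s a * P h s a s'|
    ≤ 2 * √(visits x k h s a * P h s a s' * (2 * L)) + 2 * L

variable [Fintype S] [Fintype A] {P : Fin H → S → A → S → ℝ} {L δ : ℝ}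

theorem measureReal_not_countsConcentrate_le {Ω : Type*} {mΩ : MeasurableSpace Ω} {μ : Measure Ω}
    [IsProbabilityMeasure μ] {p : S → ℝ} {ℱ : Filtration (Fin K) mΩ}
    {π : Fin K → Ω → Fin H → S → A → ℝ} {X : Fin K → Ω → Traj S A H} (hp : p ∈ stdSimplex ℝ S)
    (hP : IsKernel P) (hrun : IsLearningRun μ p P ℱ π X) (hL : 0 ≤ L) :
    μ.real {ω | ¬ CountsConcentrate P L fun j => X j ω}
      ≤ 2 * (K ^ 2 * H * Fintype.card S ^ 2 * Fintype.card A) * Real.exp (-(2 * L)) := by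
  -- The visit count is random, so the union bound also runs over its possible values `n < K`.
  let B : Fin K × Fin K × Fin H × S × A × S × ({-1, 1} : Finset ℝ) → Set Ω :=
    fun (k, n, h, s, a, s', σ) =>
      {ω | visits (fun j => X j ω) k h s a = (n : ℕ) ∧
        2 * √((n : ℕ) * P h s a s' * (2 * L)) + 2 * L
          ≤ σ * (transitions (fun j => X j ω) k h s a s' - (n : ℕ) * P h s a s')}
  have hB (i) : μ.real (B i) ≤ Real.exp (-(2 * L)) := by
    obtain ⟨k, n, h, s, a, s', σ, hσ⟩ := i
    refine measureReal_visits_eq_and_le hp hP hrun k h s a s' n (by positivity) ?_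
    rcases Finset.mem_insert.1 hσ with rfl | hσ
    · simp
    · simp [Finset.mem_singleton.1 hσ]
  have hsub : {ω | ¬ CountsConcentrate P L fun j => X j ω} ⊆ ⋃ i, B i := by
    intro ω hω
    simp only [Set.mem_ofPred_eq, CountsConcentrate, not_forall, not_le] at hω
    obtain ⟨k, h, s, a, s', hdev⟩ := hω
    let n : Fin K := ⟨_, visits_lt (fun j => X j ω) k h s a⟩
    rw [Set.mem_iUnion]
    rcases lt_abs.1 hdev with hdev | hdev
    · exact ⟨(k, n, h, s, a, s', ⟨1, by simp⟩), rfl, by simpa only [one_mul] using hdev.le⟩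
    · exact ⟨(k, n, h, s, a, s', ⟨-1, by simp⟩), rfl, by simpa only [neg_one_mul] using hdev.le⟩
  calc μ.real {ω | ¬ CountsConcentrate P L fun j => X j ω}
      ≤ μ.real (⋃ i, B i) := measureReal_mono hsub
    _ ≤ ∑ i, μ.real (B i) := measureReal_iUnion_fintype_le _
    _ ≤ ∑ _i, Real.exp (-(2 * L)) := Finset.sum_le_sum fun i _ => hB i
    _ = _ := by
        have hcard : ({-1, 1} : Finset ℝ).card = 2 := Finset.card_pair (by norm_num)
        simp only [Finset.sum_const, Finset.card_univ, Fintype.card_prod, Fintype.card_coe,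
          hcard, Fintype.card_fin, nsmul_eq_mul]
        push_cast
        ring

theorem one_sub_le_measureReal_countsConcentrate {Ω : Type*} {mΩ : MeasurableSpace Ω}
    {μ : Measure Ω} [IsProbabilityMeasure μ] {p : S → ℝ} {ℱ : Filtration (Fin K) mΩ}
    {π : Fin K → Ω → Fin H → S → A → ℝ} {X : Fin K → Ω → Traj S A H} (hp : p ∈ stdSimplex ℝ S)
    (hP : IsKernel P) (hrun : IsLearningRun μ p P ℱ π X) (hδ0 : 0 < δ) (hδ1 : δ ≤ 1) :
    1 - 2 * δ ≤ μ.real {ω | CountsConcentrate P (logTerm S A H K δ) fun j => X j ω} := by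
  let good : Set Ω := {ω | CountsConcentrate P (logTerm S A H K δ) fun j => X j ω}
  have hbad : μ.real goodᶜ ≤ 2 * δ := by
    refine (measureReal_not_countsConcentrate_le hp hP hrun (logTerm_nonneg hδ0 hδ1)).trans ?_
    rw [mul_assoc]
    gcongr
    exact card_mul_exp_neg_two_mul_logTerm_le hδ0 hδ1
  have hunion : μ.real Set.univ ≤ μ.real good + μ.real goodᶜ := by
    rw [← Set.union_compl_self good]
    exact measureReal_union_le good goodᶜ
  rw [probReal_univ] at hunion
  linarith

end GoodEvent

section Bernstein

theorem abs_sub_le_of_bernstein {p q r x : ℝ} (hp : 0 ≤ p) (hq : 0 ≤ q) (hr : 0 ≤ r) (hx : 0 ≤ x)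
    (hqr : |q - r| ≤ 2 * √(r * x) + 14 / 3 * x) (hrp : |r - p| ≤ 2 * √(2 * (p * x)) + 2 * x) :
    |p - q| ≤ 5 * √(q * x) + 40 * x := by
  rw [Real.sqrt_mul hr] at hqr
  rw [Real.sqrt_mul zero_le_two, Real.sqrt_mul hp] at hrp
  rw [Real.sqrt_mul hq]
  obtain ⟨a, ha, rfl⟩ : ∃ a, 0 ≤ a ∧ a ^ 2 = q := ⟨√q, Real.sqrt_nonneg q, Real.sq_sqrt hq⟩
  obtain ⟨b, hb, rfl⟩ : ∃ b, 0 ≤ b ∧ b ^ 2 = r := ⟨√r, Real.sqrt_nonneg r, Real.sq_sqrt hr⟩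
  obtain ⟨c, hc, rfl⟩ : ∃ c, 0 ≤ c ∧ c ^ 2 = p := ⟨√p, Real.sqrt_nonneg p, Real.sq_sqrt hp⟩
  obtain ⟨d, hd, rfl⟩ : ∃ d, 0 ≤ d ∧ d ^ 2 = x := ⟨√x, Real.sqrt_nonneg x, Real.sq_sqrt hx⟩
  rw [Real.sqrt_sq hb, Real.sqrt_sq hd] at hqr
  rw [Real.sqrt_sq hc, Real.sqrt_sq hd] at hrp
  rw [Real.sqrt_sq ha, Real.sqrt_sq hd]
  have hsqrt2 : √2 ≤ 1.415 := Real.sqrt_le_iff.2 (by norm_num)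
  have hrp' : |b ^ 2 - c ^ 2| ≤ 2.83 * (c * d) + 2 * d ^ 2 := by
    linarith [mul_le_mul_of_nonneg_right hsqrt2 (mul_nonneg hc hd)]
  have hba : b ≤ a + 3.5 * d := by
    by_contra! hlt
    nlinarith [(abs_le.1 hqr).1, mul_nonneg ha hd, mul_nonneg hd hd]
  have hcb : c ≤ b + 3.5 * d := by
    by_contra! hlt
    nlinarith [(abs_le.1 hrp').1, mul_nonneg hb hd, mul_nonneg hd hd]
  have hca : c ≤ a + 7 * d := by linarith
  calc |c ^ 2 - a ^ 2| ≤ |b ^ 2 - c ^ 2| + |a ^ 2 - b ^ 2| := by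
        rw [abs_sub_comm (b ^ 2), abs_sub_comm (a ^ 2)]
        exact abs_sub_le ..
    _ ≤ 2.83 * (c * d) + 2 * d ^ 2 + (2 * (b * d) + 14 / 3 * d ^ 2) := add_le_add hrp' hqr
    _ ≤ 2.83 * ((a + 7 * d) * d) + 2 * d ^ 2 + (2 * ((a + 3.5 * d) * d) + 14 / 3 * d ^ 2) := by
        gcongr
    _ ≤ 5 * (a * d) + 40 * d ^ 2 := by nlinarith [mul_nonneg ha hd, sq_nonneg d]

theorem abs_div_max_sub_le {M N : ℕ} {q L : ℝ} (hMN : M ≤ N) (hq : q ∈ Set.Icc (0 : ℝ) 1)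
    (hL : 1 ≤ L) (h : |(M : ℝ) - N * q| ≤ 2 * √(N * q * (2 * L)) + 2 * L) :
    |(M : ℝ) / max 1 (N : ℝ) - q|
      ≤ 2 * √(2 * (q * (L / max 1 ((N : ℝ) - 1)))) + 2 * (L / max 1 ((N : ℝ) - 1)) := by
  rcases Nat.eq_zero_or_pos N with rfl | hN
  · obtain rfl : M = 0 := Nat.le_zero.1 hMN
    have hle : q ≤ 2 * √(2 * (q * L)) + 2 * L := by linarith [Real.sqrt_nonneg (2 * (q * L)), hq.2]
    simpa [abs_of_nonneg hq.1] using hle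
  · have hN1 : (1 : ℝ) ≤ N := Nat.one_le_cast.2 hN
    have hN0 : (0 : ℝ) < N := Nat.cast_pos.2 hN
    have hq0 : 0 ≤ q := hq.1
    have hmax : max 1 ((N : ℝ) - 1) ≤ N := max_le hN1 (sub_le_self _ zero_le_one)
    have : 0 < max 1 ((N : ℝ) - 1) := lt_max_of_lt_left one_pos
    have hle : L / N ≤ L / max 1 ((N : ℝ) - 1) := by gcongr
    have hsqrt : √(N * q * (2 * L)) / N = √(2 * (q * (L / N))) := by
      rw [← Real.sqrt_sq hN0.le, ← Real.sqrt_div' _ (sq_nonneg _), Real.sqrt_sq hN0.le]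
      congr 1
      field_simp
    calc |(M : ℝ) / max 1 (N : ℝ) - q| = |(M : ℝ) - N * q| / N := by
          rw [max_eq_right hN1, ← abs_of_pos hN0, ← abs_div, abs_of_pos hN0, sub_div,
            mul_div_cancel_left₀ _ hN0.ne']
      _ ≤ (2 * √(N * q * (2 * L)) + 2 * L) / N := by gcongr
      _ = 2 * √(2 * (q * (L / N))) + 2 * (L / N) := by
          rw [add_div, mul_div_assoc, mul_div_assoc, hsqrt]
      _ ≤ _ := by gcongr

end Bernstein

section Pessimism

variable {S A : Type*} [Fintype S] [Fintype A] [DecidableEq S] [DecidableEq A] {H K : ℕ}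
  {P Q : Fin H → S → A → S → ℝ} {δ : ℝ} {x : Fin K → Traj S A H} {k : Fin K}

theorem CountsConcentrate.abs_sub_le (hP : IsKernel P) (hL : 1 ≤ logTerm S A H K δ)
    (hx : CountsConcentrate P (logTerm S A H K δ) x) (hQ : Q ∈ confidenceSet δ x k) (h : Fin H)
    (s : S) (a : A) (s' : S) :
    |P h s a s' - Q h s a s'| ≤ 5 * √(Q h s a s' * (logTerm S A H K δ / effVisits x k h s a))
      + 40 * (logTerm S A H K δ / effVisits x k h s a) := by
  have hn := effVisits_pos x k h s a
  have hemp : 0 ≤ empKernel x k h s a s' := by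
    rw [empKernel]
    positivity
  refine abs_sub_le_of_bernstein ((hP h s a).1 s') ((hQ.1 h s a).1 s') hemp (by positivity) ?_ <|
    abs_div_max_sub_le (transitions_le_visits x k h s a s')
      (mem_Icc_of_mem_stdSimplex (hP h s a) s') hL (hx k h s a s')
  calc |Q h s a s' - empKernel x k h s a s'| ≤ radius δ x k h s a s' := hQ.2 h s a s'
    _ = _ := by
        rw [radius, mul_div_assoc, mul_div_mul_comm]

theorem one_add_inv_pow_le (hH : 0 < H) : (1 + 1 / (10 * (H : ℝ))) ^ H ≤ 10 / 9 := by
  calc (1 + 1 / (10 * (H : ℝ))) ^ H ≤ Real.exp (1 / (10 * (H : ℝ))) ^ H := by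
        gcongr
        rw [add_comm]
        exact Real.add_one_le_exp _
    _ = Real.exp (1 / 10) := by
        rw [← Real.exp_nat_mul]
        congr 1
        field_simp
    _ ≤ 1 / (1 - 1 / 10) :=
        Real.exp_bound_div_one_sub_of_interval (by norm_num) (by norm_num)
    _ = 10 / 9 := by norm_num

-- The choice of `c` gives the term free of `x` its coefficient `4`; then `5 ^ 2 / (4 * c)`
-- contributes `(5 / 4 * γ) ^ 2 * w'`, which is why `γ` has to be close to `1`.
theorem perturbation_coeff_le {γ T σ w w' x c : ℝ} (hγ0 : 0 < γ) (hγ : γ ≤ 10 / 9) (hT : 1 ≤ T)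
    (hσ : 1 ≤ σ) (hw : 0 < w) (hw' : 0 ≤ w') (hww' : w * w' = T) (hx : 0 ≤ x)
    (hc : c = 4 * σ * w / (γ * T)) :
    γ * (c * T + σ * (5 ^ 2 / (4 * c) + T * (2 * 40 + 5 ^ 2 / (4 * (1 / (10 * T))))) * x)
      ≤ 4 * σ * w + (2 * w' + 10 ^ 4 * T ^ 2 * σ ^ 2) * x := by
  have : 0 < T := by linarith
  have : 0 < σ := by linarith
  have hcT : γ * (c * T) = 4 * σ * w := by
    rw [hc]
    field_simp
  have hinv : γ * (σ * (5 ^ 2 / (4 * c))) = (5 / 4 * γ) ^ 2 * w' := by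
    rw [hc, ← hww']
    field_simp
  have hlam : (5 : ℝ) ^ 2 / (4 * (1 / (10 * T))) = 62.5 * T := by
    field_simp
    norm_num
  have hlead : (5 / 4 * γ) ^ 2 * w' ≤ 2 * w' := by
    gcongr
    nlinarith
  have hlow : γ * (σ * (T * (2 * 40 + 62.5 * T))) ≤ 10 ^ 4 * T ^ 2 * σ ^ 2 := by
    calc γ * (σ * (T * (2 * 40 + 62.5 * T)))
        ≤ 10 / 9 * (σ ^ 2 * (T * (142.5 * T))) := by
          gcongr
          · exact le_self_pow₀ hσ two_ne_zero
          · linarith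
      _ ≤ _ := by nlinarith [mul_nonneg (sq_nonneg σ) (sq_nonneg T)]
  calc γ * (c * T + σ * (5 ^ 2 / (4 * c) + T * (2 * 40 + 5 ^ 2 / (4 * (1 / (10 * T))))) * x)
      = γ * (c * T)
        + (γ * (σ * (5 ^ 2 / (4 * c))) + γ * (σ * (T * (2 * 40 + 62.5 * T)))) * x := by
        rw [hlam]
        ring
    _ ≤ _ := by
        rw [hcT, hinv]
        gcongr

theorem perturbation_le_pessimism [Nonempty S] [Nonempty A] (hH : 0 < H) (hK : 0 < K)
    (hL : 1 ≤ logTerm S A H K δ) (x : Fin K → Traj S A H) (k : Fin K) (h : Fin H) (s : S) (a : A)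
    {γ c : ℝ} (hγ : γ = (1 + 1 / (10 * (H : ℝ))) ^ H)
    (hc : c = 4 * Fintype.card S * √(H * Fintype.card A / K) / (γ * H)) :
    γ * (c * H + Fintype.card S * (5 ^ 2 / (4 * c)
        + H * (2 * 40 + 5 ^ 2 / (4 * (1 / (10 * (H : ℝ)))))) *
          (logTerm S A H K δ / effVisits x k h s a))
      ≤ pessimism δ x k h s a := by
  have hn := effVisits_pos x k h s a
  have hvareps : 0 ≤ vareps δ x k h s a := by
    rw [vareps]
    positivity
  have hww' : √((H : ℝ) * Fintype.card A / K) * √((H : ℝ) * K / Fintype.card A) = H := by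
    rw [← Real.sqrt_mul (by positivity)]
    field_simp
    exact Real.sqrt_sq H.cast_nonneg
  have heta : 10 ^ 4 * (H : ℝ) ^ 2 * Fintype.card S ^ 2 * logTerm S A H K δ ≤ eta S A H K δ := by
    rw [eta]
    gcongr
    · exact le_add_of_nonneg_left (by positivity)
    · exact le_self_pow₀ hL two_ne_zero
  have hcoeff := perturbation_coeff_le (x := logTerm S A H K δ / effVisits x k h s a)
    (hγ ▸ by positivity) (hγ ▸ one_add_inv_pow_le hH) (Nat.one_le_cast.2 hH)
    (Nat.one_le_cast.2 Fintype.card_pos) (Real.sqrt_pos.2 (by positivity)) (Real.sqrt_nonneg _)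
    hww' (by positivity) hc
  calc _ ≤ _ := hcoeff
    _ = 4 * Fintype.card S * √(H * Fintype.card A / K)
        + (2 * √(H * K / Fintype.card A) * logTerm S A H K δ
          + 10 ^ 4 * (H : ℝ) ^ 2 * Fintype.card S ^ 2 * logTerm S A H K δ)
            / effVisits x k h s a := by ring
    _ ≤ 8 * √(H : ℝ) * vareps δ x k h s a + 4 * Fintype.card S * √(H * Fintype.card A / K)
        + (2 * √(H * K / Fintype.card A) * logTerm S A H K δ + eta S A H K δ)
            / effVisits x k h s a := by
        gcongr
        exact le_add_of_nonneg_left (by positivity)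
    _ = _ := rfl

theorem CountsConcentrate.abs_value_sub_le_value_pessimism {p : S → ℝ} (hp : p ∈ stdSimplex ℝ S)
    (hP : IsKernel P) (hδ0 : 0 < δ) (hδ : δ ≤ 1 / 3)
    (hx : CountsConcentrate P (logTerm S A H K δ) x) {π : Fin H → S → A → ℝ} (hπ : IsPolicy π)
    (hQ : Q ∈ confidenceSet δ x k) {g : Fin H → S → A → ℝ}
    (hg : ∀ h s a, g h s a ∈ Set.Icc (0 : ℝ) 1) :
    |value p π g P - value p π g Q| ≤ value p π (pessimism δ x k) Q := by
  rcases H.eq_zero_or_pos with rfl | hH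
  · simp [value]
  have hS : Nonempty S := nonempty_of_mem_stdSimplex hp
  have hA : Nonempty A := nonempty_of_mem_stdSimplex (hπ ⟨0, hH⟩ hS.some)
  have hK : 0 < K := k.pos
  have hL : 1 ≤ logTerm S A H K δ := one_le_logTerm hH hK hδ0 hδ
  have hperturb := abs_value_sub_le hp hP hQ.1 hπ hg (lam := 1 / (10 * (H : ℝ)))
    (c := 4 * Fintype.card S * √(H * Fintype.card A / K)
      / ((1 + 1 / (10 * (H : ℝ))) ^ H * H))
    (fun h s a => div_nonneg (zero_le_one.trans hL) (effVisits_pos x k h s a).le) (by norm_num)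
    (by positivity) (by positivity) (hx.abs_sub_le hP hL hQ)
  exact hperturb.trans <| value_mono hp.1 hQ.1 hπ fun h s a =>
    perturbation_le_pessimism hH hK hL x k h s a rfl rfl

end Pessimism

end CMDP

theorem mainTheorem2 {S A : Type*} [Fintype S] [Fintype A] [DecidableEq S] [DecidableEq A]
    {H K : ℕ} {Ω : Type*} [mΩ : MeasurableSpace Ω] (μ : Measure Ω) [IsProbabilityMeasure μ]
    (p : S → ℝ) (hp : p ∈ stdSimplex ℝ S)
    (P : Fin H → S → A → S → ℝ) (hP : CMDP.IsKernel P)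
    (ℱ : Filtration (Fin K) mΩ)
    (π : Fin K → Ω → Fin H → S → A → ℝ) (X : Fin K → Ω → CMDP.Traj S A H)
    (hrun : CMDP.IsLearningRun μ p P ℱ π X)
    (δ : ℝ) (hδ0 : 0 < δ) (hδ1 : δ < 1) :
    1 - 14 * δ ≤ μ.real {ω | ∀ k : Fin K,
      ∀ πk : Fin H → S → A → ℝ, CMDP.IsPolicy πk →
      ∀ Pk ∈ CMDP.confidenceSet δ (fun j => X j ω) k,
      ∀ g : Fin H → S → A → ℝ, (∀ h s a, g h s a ∈ Set.Icc (0 : ℝ) 1) →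
        |CMDP.value p πk g P - CMDP.value p πk g Pk|
          ≤ CMDP.value p πk (CMDP.pessimism δ (fun j => X j ω) k) Pk} := by
  rcases le_or_gt 1 (14 * δ) with hδ | hδ
  · exact (sub_nonpos.2 hδ).trans measureReal_nonneg
  have hgood := CMDP.one_sub_le_measureReal_countsConcentrate hp hP hrun hδ0 hδ1.le
  refine (by linarith : 1 - 14 * δ ≤ 1 - 2 * δ).trans (hgood.trans (measureReal_mono ?_))
  intro ω hω k πk hπk Pk hPk g hg
  exact hω.abs_value_sub_le_value_pessimism hp hP hδ0 (by linarith) hπk hPk hg
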